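/- Let $\Phi:\mathbb{R}^2\to\mathbb{R}$ be a smooth convex function satisfying the Kähler–Einstein equation $e^{-\Phi}=\det D^2\Phi$ on $\mathbb{R}^2$ (so that $D^2\Phi$ is positive definite). Equip $\mathbb{R}^2$ with the Riemannian metric $h=\Phi_{ij}\,dx^i dx^j$, where $\Phi_{ij}=\partial_{ij}\Phi$. Let $R$ be the sectional curvature of $h$, put $\lambda=4R$, and let $Lf=\Phi^{ij}\partial_{ij}f$, where $(\Phi^{ij})=(D^2\Phi)^{-1}$. Let $\nabla$, $\langle\cdot,\cdot\rangle$ and $|\cdot|$ be the gradient, the inner product and the norm of the metric $h$, so that $\langle\nabla f,\nabla g\rangle=\Phi^{ij}\,\partial_i f\,\partial_j g$. Then at every point where $8\lambda+|\nabla\Phi|^2\neq 0$, $$ 2L\lambda=(3\lambda-1)(\lambda+1)+\frac{|\nabla\Phi|^2}{8\lambda+|\nabla\Phi|^2}(3\lambda-1)^2+\frac{16|\nabla\lambda|^2+2\bigl[4(1-\lambda)+|\nabla\Phi|^2\bigr]\langle\nabla\Phi,\nabla\lambda\rangle}{8\lambda+|\nabla\Phi|^2}. $$ Moreover, at every point of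 $\mathbb{R}^2$ the identity holds after multiplication by $8\lambda+|\nabla\Phi|^2$, that is, $$ 2(8\lambda+|\nabla\Phi|^2)L\lambda=(8\lambda+|\nabla\Phi|^2)(3\lambda-1)(\lambda+1)+|\nabla\Phi|^2(3\lambda-1)^2+16|\nabla\lambda|^2+2\bigl[4(1-\lambda)+|\nabla\Phi|^2\bigr]\langle\nabla\Phi,\nabla\lambda\rangle. $$ -/

import Mathlib

open scoped ContDiff

noncomputable section

namespace HessianGeometry

/-- The `i`-th partial derivative `∂ᵢ f`. -/
def pd {n : ℕ} (i : Fin n) (f : EuclideanSpace ℝ (Fin n) → ℝ) :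
    EuclideanSpace ℝ (Fin n) → ℝ :=
  fun x => fderiv ℝ f x (EuclideanSpace.single i 1)

/-- The Euclidean Hessian `D²Φ`, with entries `Φᵢⱼ = ∂ᵢ ∂ⱼ Φ`; for strongly convex `Φ` it is
regarded as a Riemannian metric on `ℝⁿ`. -/
def hess {n : ℕ} (Φ : EuclideanSpace ℝ (Fin n) → ℝ) (x : EuclideanSpace ℝ (Fin n)) :
    Matrix (Fin n) (Fin n) ℝ :=
  Matrix.of fun i j => pd i (pd j Φ) x

/-- The inner product `⟨u, v⟩ = hᵢⱼ uⁱ vʲ` of two tangent vectors at `x`. -/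
def metricInner {n : ℕ} (h : EuclideanSpace ℝ (Fin n) → Matrix (Fin n) (Fin n) ℝ)
    (x : EuclideanSpace ℝ (Fin n)) (u v : Fin n → ℝ) : ℝ :=
  ∑ i, ∑ j, h x i j * u i * v j

/-- The Riemannian gradient `(∇f)ⁱ = hⁱʲ ∂ⱼ f`. -/
def riemGrad {n : ℕ} (h : EuclideanSpace ℝ (Fin n) → Matrix (Fin n) (Fin n) ℝ)
    (f : EuclideanSpace ℝ (Fin n) → ℝ) (x : EuclideanSpace ℝ (Fin n)) : Fin n → ℝ :=
  fun i => ∑ j, (h x)⁻¹ i j * pd j f x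

/-- The Christoffel symbols `Γᵏᵢⱼ = ½ hᵏˡ (∂ᵢ hⱼₗ + ∂ⱼ hᵢₗ - ∂ₗ hᵢⱼ)` of the Levi-Civita
connection of the metric `h`. -/
def christoffel {n : ℕ} (h : EuclideanSpace ℝ (Fin n) → Matrix (Fin n) (Fin n) ℝ)
    (k i j : Fin n) (x : EuclideanSpace ℝ (Fin n)) : ℝ :=
  (1 / 2) * ∑ l, (h x)⁻¹ k l *
    (pd i (fun y => h y j l) x + pd j (fun y => h y i l) x - pd l (fun y => h y i j) x)

/-- The `l`-th component of `R(∂ᵢ, ∂ⱼ)∂ₖ`, where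
`R(X, Y)Z = ∇_X ∇_Y Z - ∇_Y ∇_X Z - ∇_[X,Y] Z`. -/
def riemannCurv {n : ℕ} (h : EuclideanSpace ℝ (Fin n) → Matrix (Fin n) (Fin n) ℝ)
    (l i j k : Fin n) (x : EuclideanSpace ℝ (Fin n)) : ℝ :=
  pd i (christoffel h l j k) x - pd j (christoffel h l i k) x +
    ∑ m, (christoffel h l i m x * christoffel h m j k x -
      christoffel h l j m x * christoffel h m i k x)

/-- The sectional curvature `⟨R(u, v)v, u⟩ / (⟨u, u⟩⟨v, v⟩ - ⟨u, v⟩²)` of the plane spanned by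
the linearly independent tangent vectors `u`, `v` at `x`. -/
def sectionalCurvature {n : ℕ} (h : EuclideanSpace ℝ (Fin n) → Matrix (Fin n) (Fin n) ℝ)
    (x : EuclideanSpace ℝ (Fin n)) (u v : Fin n → ℝ) : ℝ :=
  metricInner h x (fun l => ∑ i, ∑ j, ∑ k, riemannCurv h l i j k x * u i * v j * v k) u /
    (metricInner h x u u * metricInner h x v v - metricInner h x u v ^ 2)

/-- `λ = 4R`, where `R` is the sectional curvature of the Hessian metric `D²Φ` on `ℝ²`; the only
tangent plane at a point is spanned by the two coordinate vectors. -/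
def lam (Φ : EuclideanSpace ℝ (Fin 2) → ℝ) (x : EuclideanSpace ℝ (Fin 2)) : ℝ :=
  4 * sectionalCurvature (hess Φ) x (Pi.single 0 1) (Pi.single 1 1)

/-- The weighted Laplacian `L f = Φⁱʲ ∂ᵢ ∂ⱼ f`. -/
def weightedLaplacian {n : ℕ} (Φ f : EuclideanSpace ℝ (Fin n) → ℝ)
    (x : EuclideanSpace ℝ (Fin n)) : ℝ :=
  ∑ i, ∑ j, (hess Φ x)⁻¹ i j * pd i (pd j f) x

/-- `⟨∇f, ∇g⟩`, with gradients and inner product taken in the Hessian metric `D²Φ`. -/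
def gradInner {n : ℕ} (Φ f g : EuclideanSpace ℝ (Fin n) → ℝ)
    (x : EuclideanSpace ℝ (Fin n)) : ℝ :=
  metricInner (hess Φ) x (riemGrad (hess Φ) f x) (riemGrad (hess Φ) g x)

end HessianGeometry

end

/-! The trace-free part of the cubic form `D³Φ` has squared norm proportional to `8λ + |∇Φ|²`. In a
frame in which `D²Φ` is the identity at the given point, the derivatives of order one, two and
three of the Kähler–Einstein equation express the traces of `D³Φ`, `D⁴Φ` and `D⁵Φ` through
derivatives of lower order. This gives a Bochner formula expressing `Lλ` through `λ`, `|∇Φ|²` and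
the squared norm of the trace-free part of `∇D³Φ`. In dimension two trace-free symmetric forms are
complex numbers, so that Kato's inequality is an equality: the product of that squared norm with
`8λ + |∇Φ|²` is proportional to the squared norm of a combination of `∇λ` and `∇Φ`. -/

namespace HessianGeometry

section DirectionalDerivative

variable {V : Type*} [NormedAddCommGroup V] [NormedSpace ℝ V] {U : Set V} {f g : V → ℝ} {v w x : V}

/-- The directional derivative `∂ᵥ f`, as an operator on functions so that it can be iterated. -/
noncomputable def dirDeriv (v : V) (f : V → ℝ) : V → ℝ := fun x => fderiv ℝ f x v

theorem dirDeriv_const (c : ℝ) : dirDeriv v (fun _ => c) x = 0 := by simp [dirDeriv]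

theorem dirDeriv_neg : dirDeriv v (fun y => -f y) x = -dirDeriv v f x := by simp [dirDeriv]

theorem dirDeriv_add (hf : DifferentiableAt ℝ f x) (hg : DifferentiableAt ℝ g x) :
    dirDeriv v (fun y => f y + g y) x = dirDeriv v f x + dirDeriv v g x := by
  simp [dirDeriv, fderiv_fun_add hf hg]

theorem dirDeriv_sub (hf : DifferentiableAt ℝ f x) (hg : DifferentiableAt ℝ g x) :
    dirDeriv v (fun y => f y - g y) x = dirDeriv v f x - dirDeriv v g x := by
  simp [dirDeriv, fderiv_fun_sub hf hg]

theorem dirDeriv_mul (hf : DifferentiableAt ℝ f x) (hg : DifferentiableAt ℝ g x) :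
    dirDeriv v (fun y => f y * g y) x = dirDeriv v f x * g x + f x * dirDeriv v g x := by
  simp only [dirDeriv, fderiv_fun_mul hf hg, add_apply, smul_apply, smul_eq_mul]
  ring

theorem dirDeriv_pow (hf : DifferentiableAt ℝ f x) (k : ℕ) :
    dirDeriv v (fun y => f y ^ k) x = k * f x ^ (k - 1) * dirDeriv v f x := by
  simp [dirDeriv, fderiv_fun_pow k hf]

theorem dirDeriv_exp (hf : DifferentiableAt ℝ f x) :
    dirDeriv v (fun y => Real.exp (f y)) x = Real.exp (f x) * dirDeriv v f x := by
  simp [dirDeriv, fderiv_exp hf]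

theorem dirDeriv_sum {ι : Type*} {s : Finset ι} {F : ι → V → ℝ}
    (hF : ∀ i ∈ s, DifferentiableAt ℝ (F i) x) :
    dirDeriv v (fun y => ∑ i ∈ s, F i y) x = ∑ i ∈ s, dirDeriv v (F i) x := by
  simp [dirDeriv, fderiv_fun_sum hF]

theorem dirDeriv_congr (hU : IsOpen U) (hfg : Set.EqOn f g U) (hx : x ∈ U) :
    dirDeriv v f x = dirDeriv v g x := by
  rw [dirDeriv, dirDeriv, (hfg.eventuallyEq_of_mem (hU.mem_nhds hx)).fderiv_eq]

theorem contDiffOn_dirDeriv (hU : IsOpen U) (hf : ContDiffOn ℝ ∞ f U) :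
    ContDiffOn ℝ ∞ (dirDeriv v f) U :=
  (hf.fderiv_of_isOpen hU (m := ∞) le_rfl).clm_apply contDiffOn_const

theorem dirDeriv_comm (hf : ContDiffAt ℝ 2 f x) :
    dirDeriv v (dirDeriv w f) x = dirDeriv w (dirDeriv v f) x := by
  have hdf : DifferentiableAt ℝ (fderiv ℝ f) x :=
    (hf.fderiv_right (m := 1) (by norm_num)).differentiableAt (by simp)
  have hsymm : IsSymmSndFDerivAt ℝ f x := hf.isSymmSndFDerivAt (by simp)
  unfold dirDeriv
  rw [fderiv_clm_apply hdf (by fun_prop), fderiv_clm_apply hdf (by fun_prop)]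
  simpa using hsymm v w

/-- The iterated derivative `∂_{e i₁} ⋯ ∂_{e iₖ} f` along the members of a frame `e` indexed by the
list `[i₁, …, iₖ]`. -/
noncomputable def iterDirDeriv {ι : Type*} (e : ι → V) (f : V → ℝ) (l : List ι) : V → ℝ :=
  l.foldr (fun i => dirDeriv (e i)) f

variable {ι : Type*} {e : ι → V}

theorem dirDeriv_iterDirDeriv (i : ι) (l : List ι) :
    dirDeriv (e i) (iterDirDeriv e f l) = iterDirDeriv e f (i :: l) := rfl

theorem contDiffOn_iterDirDeriv (hU : IsOpen U) (hf : ContDiffOn ℝ ∞ f U) (l : List ι) :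
    ContDiffOn ℝ ∞ (iterDirDeriv e f l) U := by
  induction l with
  | nil => exact hf
  | cons i l ih => exact contDiffOn_dirDeriv hU ih

theorem differentiableAt_iterDirDeriv (hU : IsOpen U) (hf : ContDiffOn ℝ ∞ f U) (hx : x ∈ U)
    (l : List ι) : DifferentiableAt ℝ (iterDirDeriv e f l) x :=
  ((contDiffOn_iterDirDeriv hU hf l).contDiffAt (hU.mem_nhds hx)).differentiableAt (by simp)

theorem eqOn_iterDirDeriv_of_perm (hU : IsOpen U) (hf : ContDiffOn ℝ ∞ f U) {l l' : List ι}
    (h : l.Perm l') : Set.EqOn (iterDirDeriv e f l) (iterDirDeriv e f l') U := by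
  induction h with
  | nil => exact fun _ _ => rfl
  | cons i _ ih => exact fun _ hx => dirDeriv_congr hU ih hx
  | swap i j l =>
    exact fun x hx => dirDeriv_comm
      (((contDiffOn_iterDirDeriv hU hf l).contDiffAt (hU.mem_nhds hx)).of_le ENat.LEInfty.out)
  | trans _ _ ih ih' => exact ih.trans ih'

/-- The mixed derivative `∂_{e 0}ᵐ ∂_{e 1}ⁿ f` along a frame of two vectors. -/
noncomputable def frameJet (e : Fin 2 → V) (f : V → ℝ) (x : V) (m n : ℕ) : ℝ :=
  iterDirDeriv e f (List.replicate m 0 ++ List.replicate n 1) x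

theorem iterDirDeriv_eq_frameJet {e : Fin 2 → V} (hU : IsOpen U) (hf : ContDiffOn ℝ ∞ f U)
    (hx : x ∈ U) (l : List (Fin 2)) :
    iterDirDeriv e f l x = frameJet e f x (l.count 0) (l.count 1) := by
  refine eqOn_iterDirDeriv_of_perm hU hf (List.perm_iff_count.2 fun i => ?_) hx
  fin_cases i <;> simp [List.count_replicate]

end DirectionalDerivative

section FrameDeterminants

variable {V : Type*} [NormedAddCommGroup V] [NormedSpace ℝ V] {U : Set V} {e : Fin 2 → V}
  {f : V → ℝ} {l m n : List (Fin 2)} {x : V}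

/-- The polarized determinant of the matrices `∂_l D²f` and `∂_m D²f`, where `D²f` is the Hessian of
`f` in the frame `e`; for `l = m = []` it is twice the Hessian determinant. -/
noncomputable def hessPolarDet (e : Fin 2 → V) (f : V → ℝ) (l m : List (Fin 2)) (x : V) : ℝ :=
  iterDirDeriv e f (l ++ [0, 0]) x * iterDirDeriv e f (m ++ [1, 1]) x
    + iterDirDeriv e f (l ++ [1, 1]) x * iterDirDeriv e f (m ++ [0, 0]) x
    - 2 * (iterDirDeriv e f (l ++ [0, 1]) x * iterDirDeriv e f (m ++ [0, 1]) x)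

/-- Minus the determinant of the `3 × 3` matrix whose rows list the entries `00`, `01`, `11` of
`∂_l D²f`, `∂_m D²f` and `∂_n D²f`, where `D²f` is the Hessian of `f` in the frame `e`. -/
noncomputable def hessTripleDet (e : Fin 2 → V) (f : V → ℝ) (l m n : List (Fin 2)) (x : V) : ℝ :=
  iterDirDeriv e f (l ++ [0, 0]) x *
      (iterDirDeriv e f (m ++ [1, 1]) x * iterDirDeriv e f (n ++ [0, 1]) x
        - iterDirDeriv e f (m ++ [0, 1]) x * iterDirDeriv e f (n ++ [1, 1]) x)
    + iterDirDeriv e f (l ++ [0, 1]) x *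
      (iterDirDeriv e f (m ++ [0, 0]) x * iterDirDeriv e f (n ++ [1, 1]) x
        - iterDirDeriv e f (m ++ [1, 1]) x * iterDirDeriv e f (n ++ [0, 0]) x)
    + iterDirDeriv e f (l ++ [1, 1]) x *
      (iterDirDeriv e f (m ++ [0, 1]) x * iterDirDeriv e f (n ++ [0, 0]) x
        - iterDirDeriv e f (m ++ [0, 0]) x * iterDirDeriv e f (n ++ [0, 1]) x)

theorem hessPolarDet_comm (l m : List (Fin 2)) :
    hessPolarDet e f l m x = hessPolarDet e f m l x := by
  unfold hessPolarDet
  ring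

theorem differentiableAt_hessPolarDet (hU : IsOpen U) (hf : ContDiffOn ℝ ∞ f U) (hx : x ∈ U)
    (l m : List (Fin 2)) : DifferentiableAt ℝ (hessPolarDet e f l m) x := by
  have hd := differentiableAt_iterDirDeriv (e := e) hU hf hx
  unfold hessPolarDet
  fun_prop

theorem differentiableAt_hessTripleDet (hU : IsOpen U) (hf : ContDiffOn ℝ ∞ f U) (hx : x ∈ U)
    (l m n : List (Fin 2)) : DifferentiableAt ℝ (hessTripleDet e f l m n) x := by
  have hd := differentiableAt_iterDirDeriv (e := e) hU hf hx
  unfold hessTripleDet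
  fun_prop

theorem dirDeriv_hessPolarDet (hU : IsOpen U) (hf : ContDiffOn ℝ ∞ f U) (hx : x ∈ U) (i : Fin 2) :
    dirDeriv (e i) (hessPolarDet e f l m) x =
      hessPolarDet e f (i :: l) m x + hessPolarDet e f l (i :: m) x := by
  have hd := differentiableAt_iterDirDeriv (e := e) hU hf hx
  unfold hessPolarDet
  simp (disch := fun_prop) only [dirDeriv_mul, dirDeriv_add, dirDeriv_sub, dirDeriv_const,
    dirDeriv_iterDirDeriv, List.cons_append]
  ring

theorem dirDeriv_hessTripleDet (hU : IsOpen U) (hf : ContDiffOn ℝ ∞ f U) (hx : x ∈ U)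
    (i : Fin 2) :
    dirDeriv (e i) (hessTripleDet e f l m n) x = hessTripleDet e f (i :: l) m n x
      + hessTripleDet e f l (i :: m) n x + hessTripleDet e f l m (i :: n) x := by
  have hd := differentiableAt_iterDirDeriv (e := e) hU hf hx
  unfold hessTripleDet
  simp (disch := fun_prop) only [dirDeriv_mul, dirDeriv_add, dirDeriv_sub, dirDeriv_iterDirDeriv,
    List.cons_append]
  ring

end FrameDeterminants

section MongeAmpere

variable {V : Type*} [NormedAddCommGroup V] [NormedSpace ℝ V] {U : Set V} {e : Fin 2 → V}
  {φ : V → ℝ} {κ : ℝ} {x : V}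

local notation "𝒟" => iterDirDeriv e φ
local notation "𝒬" => hessPolarDet e φ

theorem dirDeriv_hessDet (hU : IsOpen U) (hφ : ContDiffOn ℝ ∞ φ U)
    (hKE : ∀ y ∈ U, 𝒬 [] [] y = κ * Real.exp (-φ y)) (hx : x ∈ U) (i : Fin 2) :
    dirDeriv (e i) (𝒬 [] []) x = -(𝒬 [] [] x * 𝒟 [i] x) := by
  have hd : DifferentiableAt ℝ φ x := differentiableAt_iterDirDeriv (e := e) hU hφ hx []
  rw [dirDeriv_congr hU hKE hx, hKE x hx]
  simp (disch := fun_prop) only [dirDeriv_mul, dirDeriv_const, dirDeriv_exp, dirDeriv_neg]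
  simp only [iterDirDeriv, List.foldr]
  ring

theorem kahlerEinstein_deriv₁ (hU : IsOpen U) (hφ : ContDiffOn ℝ ∞ φ U)
    (hKE : ∀ y ∈ U, 𝒬 [] [] y = κ * Real.exp (-φ y)) (hx : x ∈ U) (i : Fin 2) :
    2 * 𝒬 [] [i] x = -(𝒬 [] [] x * 𝒟 [i] x) := by
  rw [← dirDeriv_hessDet hU hφ hKE hx, dirDeriv_hessPolarDet hU hφ hx, hessPolarDet_comm [i]]
  ring

theorem kahlerEinstein_deriv₂ (hU : IsOpen U) (hφ : ContDiffOn ℝ ∞ φ U)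
    (hKE : ∀ y ∈ U, 𝒬 [] [] y = κ * Real.exp (-φ y)) (hx : x ∈ U) (i j : Fin 2) :
    2 * (𝒬 [j] [i] x + 𝒬 [] [j, i] x) = 𝒬 [] [] x * (𝒟 [j] x * 𝒟 [i] x - 𝒟 [j, i] x) := by
  have hd := differentiableAt_iterDirDeriv (e := e) hU hφ hx
  have hdQ := differentiableAt_hessPolarDet (e := e) hU hφ hx
  have h := dirDeriv_congr (v := e j) hU
    (fun y hy => kahlerEinstein_deriv₁ hU hφ hKE hy i) hx
  simp (disch := fun_prop) only [dirDeriv_mul, dirDeriv_neg, dirDeriv_const,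
    dirDeriv_iterDirDeriv, dirDeriv_hessDet hU hφ hKE hx] at h
  rw [dirDeriv_hessPolarDet hU hφ hx] at h
  linear_combination h

theorem kahlerEinstein_deriv₃ (hU : IsOpen U) (hφ : ContDiffOn ℝ ∞ φ U)
    (hKE : ∀ y ∈ U, 𝒬 [] [] y = κ * Real.exp (-φ y)) (hx : x ∈ U) (i j k : Fin 2) :
    2 * (𝒬 [k, j] [i] x + 𝒬 [j] [k, i] x + 𝒬 [k] [j, i] x + 𝒬 [] [k, j, i] x) =
      𝒬 [] [] x * (𝒟 [k] x * 𝒟 [j, i] x + 𝒟 [j] x * 𝒟 [k, i] x + 𝒟 [i] x * 𝒟 [k, j] x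
        - 𝒟 [k] x * 𝒟 [j] x * 𝒟 [i] x - 𝒟 [k, j, i] x) := by
  have hd := differentiableAt_iterDirDeriv (e := e) hU hφ hx
  have hdQ := differentiableAt_hessPolarDet (e := e) hU hφ hx
  have h := dirDeriv_congr (v := e k) hU
    (fun y hy => kahlerEinstein_deriv₂ hU hφ hKE hy i j) hx
  simp (disch := fun_prop) only [dirDeriv_mul, dirDeriv_sub, dirDeriv_add, dirDeriv_const,
    dirDeriv_iterDirDeriv, dirDeriv_hessDet hU hφ hKE hx] at h
  simp only [dirDeriv_hessPolarDet hU hφ hx] at h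
  linear_combination h

local notation "𝒯" => hessTripleDet e φ

variable {σ : V → ℝ}

theorem curvature_deriv₁ (hU : IsOpen U) (hφ : ContDiffOn ℝ ∞ φ U)
    (hKE : ∀ y ∈ U, 𝒬 [] [] y = κ * Real.exp (-φ y)) (hσ : ContDiffOn ℝ ∞ σ U)
    (hcurv : ∀ y ∈ U, σ y * 𝒬 [] [] y ^ 2 = 4 * 𝒯 [] [0] [1] y) (hx : x ∈ U) (i : Fin 2) :
    (dirDeriv (e i) σ x - 2 * 𝒟 [i] x * σ x) * 𝒬 [] [] x ^ 2 =
      4 * (𝒯 [i] [0] [1] x + 𝒯 [] [i, 0] [1] x + 𝒯 [] [0] [i, 1] x) := by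
  have hdQ := differentiableAt_hessPolarDet (e := e) hU hφ hx
  have hdT := differentiableAt_hessTripleDet (e := e) hU hφ hx
  have hdσ : DifferentiableAt ℝ σ x :=
    (hσ.contDiffAt (hU.mem_nhds hx)).differentiableAt (by simp)
  have h := dirDeriv_congr (v := e i) hU hcurv hx
  simp (disch := fun_prop) only [dirDeriv_mul, dirDeriv_pow, dirDeriv_const,
    dirDeriv_hessDet hU hφ hKE hx, dirDeriv_hessTripleDet hU hφ hx, Nat.cast_ofNat,
    Nat.reduceSub, pow_one] at h
  linear_combination h

theorem curvature_deriv₂ (hU : IsOpen U) (hφ : ContDiffOn ℝ ∞ φ U)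
    (hKE : ∀ y ∈ U, 𝒬 [] [] y = κ * Real.exp (-φ y)) (hσ : ContDiffOn ℝ ∞ σ U)
    (hcurv : ∀ y ∈ U, σ y * 𝒬 [] [] y ^ 2 = 4 * 𝒯 [] [0] [1] y) (hx : x ∈ U) (i : Fin 2) :
    (dirDeriv (e i) (dirDeriv (e i) σ) x - 2 * 𝒟 [i, i] x * σ x
        - 4 * 𝒟 [i] x * dirDeriv (e i) σ x + 4 * 𝒟 [i] x ^ 2 * σ x) * 𝒬 [] [] x ^ 2 =
      4 * (𝒯 [i, i] [0] [1] x + 𝒯 [] [i, i, 0] [1] x + 𝒯 [] [0] [i, i, 1] x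
        + 2 * (𝒯 [i] [i, 0] [1] x + 𝒯 [i] [0] [i, 1] x + 𝒯 [] [i, 0] [i, 1] x)) := by
  have hd := differentiableAt_iterDirDeriv (e := e) hU hφ hx
  have hdQ := differentiableAt_hessPolarDet (e := e) hU hφ hx
  have hdT := differentiableAt_hessTripleDet (e := e) hU hφ hx
  have hdσ : DifferentiableAt ℝ σ x :=
    (hσ.contDiffAt (hU.mem_nhds hx)).differentiableAt (by simp)
  have hdσ' : DifferentiableAt ℝ (dirDeriv (e i) σ) x :=
    ((contDiffOn_dirDeriv hU hσ).contDiffAt (hU.mem_nhds hx)).differentiableAt (by simp)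
  have h := dirDeriv_congr (v := e i) hU
    (fun y hy => curvature_deriv₁ hU hφ hKE hσ hcurv hy i) hx
  simp (disch := fun_prop) only [dirDeriv_mul, dirDeriv_sub, dirDeriv_add, dirDeriv_pow,
    dirDeriv_const, dirDeriv_iterDirDeriv, dirDeriv_hessDet hU hφ hKE hx,
    dirDeriv_hessTripleDet hU hφ hx, Nat.cast_ofNat, Nat.reduceSub, pow_one] at h
  linear_combination h

end MongeAmpere

section ChangeOfFrame

variable {V : Type*} [NormedAddCommGroup V] [NormedSpace ℝ V] {U : Set V} {f : V → ℝ} {x : V}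
  {ι ι' : Type*} [Fintype ι] {P : Matrix ι' ι ℝ} {e : ι → V}

/-- The frame whose members have the rows of `P` as coefficients in the frame `e`. -/
noncomputable def changeFrame (P : Matrix ι' ι ℝ) (e : ι → V) (k : ι') : V := ∑ i, P k i • e i

theorem dirDeriv_changeFrame (k : ι') :
    dirDeriv (changeFrame P e k) f x = ∑ i, P k i * dirDeriv (e i) f x := by
  simp [dirDeriv, changeFrame]

theorem dirDeriv_sum_const_mul {v : V} {c : ι → ℝ} {F : ι → V → ℝ}
    (hF : ∀ i, DifferentiableAt ℝ (F i) x) :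
    dirDeriv v (fun y => ∑ i, c i * F i y) x = ∑ i, c i * dirDeriv v (F i) x := by
  rw [dirDeriv_sum fun i _ => (hF i).const_mul (c i)]
  refine Finset.sum_congr rfl fun i _ => ?_
  rw [dirDeriv_mul (differentiableAt_const _) (hF i), dirDeriv_const, zero_mul, zero_add]

theorem iterDirDeriv_changeFrame₂ (hU : IsOpen U) (hf : ContDiffOn ℝ ∞ f U) (hx : x ∈ U)
    (k l : ι') : iterDirDeriv (changeFrame P e) f [k, l] x =
      ∑ i, P k i * ∑ j, P l j * iterDirDeriv e f [i, j] x := by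
  have hd := differentiableAt_iterDirDeriv (e := e) hU hf hx
  have hl : iterDirDeriv (changeFrame P e) f [l] = fun y => ∑ j, P l j * iterDirDeriv e f [j] y :=
    funext fun _ => dirDeriv_changeFrame l
  rw [← dirDeriv_iterDirDeriv, dirDeriv_changeFrame, hl]
  simp only [dirDeriv_sum_const_mul fun j => hd [j], dirDeriv_iterDirDeriv]

theorem iterDirDeriv_changeFrame₃ (hU : IsOpen U) (hf : ContDiffOn ℝ ∞ f U) (hx : x ∈ U)
    (k l m : ι') : iterDirDeriv (changeFrame P e) f [k, l, m] x =
      ∑ i, P k i * ∑ j, P l j * ∑ h, P m h * iterDirDeriv e f [i, j, h] x := by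
  have hd := differentiableAt_iterDirDeriv (e := e) hU hf hx
  have hd' : ∀ i, DifferentiableAt ℝ (fun y => ∑ h, P m h * iterDirDeriv e f [i, h] y) x :=
    fun i => by fun_prop
  rw [← dirDeriv_iterDirDeriv, dirDeriv_changeFrame]
  simp only [dirDeriv_congr hU (fun _ hy => iterDirDeriv_changeFrame₂ hU hf hy l m) hx]
  simp only [dirDeriv_sum_const_mul hd', dirDeriv_sum_const_mul fun h => hd [_, h],
    dirDeriv_iterDirDeriv]

end ChangeOfFrame

section HessianInFrame

variable {V : Type*} [NormedAddCommGroup V] [NormedSpace ℝ V] {U : Set V} {e : Fin 2 → V}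
  {f : V → ℝ} {x : V}

theorem hessPolarDet_changeFrame (hU : IsOpen U) (hf : ContDiffOn ℝ ∞ f U) (hx : x ∈ U)
    (P : Matrix (Fin 2) (Fin 2) ℝ) :
    hessPolarDet (changeFrame P e) f [] [] x = P.det ^ 2 * hessPolarDet e f [] [] x := by
  simp only [hessPolarDet, List.nil_append, iterDirDeriv_changeFrame₂ hU hf hx,
    Fin.sum_univ_two, Matrix.det_fin_two, iterDirDeriv_eq_frameJet hU hf hx, List.count_cons_self,
    List.count_cons_of_ne, List.count_nil, ne_eq, one_ne_zero, zero_ne_one, not_false_eq_true,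
    zero_add, Nat.reduceAdd]
  ring

theorem hessTripleDet_changeFrame (hU : IsOpen U) (hf : ContDiffOn ℝ ∞ f U) (hx : x ∈ U)
    (P : Matrix (Fin 2) (Fin 2) ℝ) :
    hessTripleDet (changeFrame P e) f [] [0] [1] x =
      P.det ^ 4 * hessTripleDet e f [] [0] [1] x := by
  simp only [hessTripleDet, List.nil_append, List.cons_append, iterDirDeriv_changeFrame₂ hU hf hx,
    iterDirDeriv_changeFrame₃ hU hf hx, Fin.sum_univ_two, Matrix.det_fin_two,
    iterDirDeriv_eq_frameJet hU hf hx, List.count_cons_self,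
    List.count_cons_of_ne, List.count_nil, ne_eq, one_ne_zero, zero_ne_one, not_false_eq_true,
    zero_add, Nat.reduceAdd]
  ring

end HessianInFrame

section HessianMetric

/-- The standard basis of `ℝⁿ` as a frame, so that `pd i` is `dirDeriv (coordFrame i)`. -/
noncomputable def coordFrame {n : ℕ} (i : Fin n) : EuclideanSpace ℝ (Fin n) :=
  EuclideanSpace.single i 1

variable {n : ℕ} {U : Set (EuclideanSpace ℝ (Fin n))} {Φ : EuclideanSpace ℝ (Fin n) → ℝ}
  {x : EuclideanSpace ℝ (Fin n)}

local notation "𝒟" => iterDirDeriv coordFrame Φ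

theorem hess_apply (i j : Fin n) : hess Φ x i j = 𝒟 [i, j] x := rfl

theorem hess_symm (hU : IsOpen U) (hΦ : ContDiffOn ℝ ∞ Φ U) (hx : x ∈ U) (i j : Fin n) :
    hess Φ x i j = hess Φ x j i :=
  eqOn_iterDirDeriv_of_perm (e := coordFrame) hU hΦ (.swap j i []) hx

theorem christoffel_hess (hU : IsOpen U) (hΦ : ContDiffOn ℝ ∞ Φ U) (hx : x ∈ U) (k i j : Fin n) :
    christoffel (hess Φ) k i j x = 1 / 2 * ∑ l, (hess Φ x)⁻¹ k l * 𝒟 [i, j, l] x := by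
  refine congrArg (1 / 2 * ·) (Finset.sum_congr rfl fun l _ => congrArg (_ * ·) ?_)
  have hjil : 𝒟 [j, i, l] x = 𝒟 [i, j, l] x :=
    eqOn_iterDirDeriv_of_perm hU hΦ (.swap i j [l]) hx
  have hlij : 𝒟 [l, i, j] x = 𝒟 [i, j, l] x :=
    eqOn_iterDirDeriv_of_perm hU hΦ (List.perm_append_comm (l₁ := [l])) hx
  change 𝒟 [i, j, l] x + 𝒟 [j, i, l] x - 𝒟 [l, i, j] x = 𝒟 [i, j, l] x
  rw [hjil, hlij, add_sub_cancel_right]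

theorem sum_hess_mul_christoffel (hU : IsOpen U) (hΦ : ContDiffOn ℝ ∞ Φ U) (hx : x ∈ U)
    (hdet : (hess Φ x).det ≠ 0) (p i j : Fin n) :
    ∑ l, hess Φ x p l * christoffel (hess Φ) l i j x = 1 / 2 * 𝒟 [i, j, p] x := by
  have hinv : hess Φ x * (hess Φ x)⁻¹ = 1 := Matrix.mul_nonsing_inv _ hdet.isUnit
  have hΓ : (fun l => christoffel (hess Φ) l i j x) =
      (1 / 2 : ℝ) • (hess Φ x)⁻¹.mulVec fun l => 𝒟 [i, j, l] x :=
    funext fun l => christoffel_hess hU hΦ hx l i j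
  change (hess Φ x).mulVec (fun l => christoffel (hess Φ) l i j x) p = _
  rw [hΓ, Matrix.mulVec_smul, Matrix.mulVec_mulVec, hinv, Matrix.one_mulVec]
  rfl

theorem contDiffOn_inv_apply {H : EuclideanSpace ℝ (Fin n) → Matrix (Fin n) (Fin n) ℝ}
    (hH : ∀ i j, ContDiffOn ℝ ∞ (fun y => H y i j) U) (hdet : ∀ y ∈ U, (H y).det ≠ 0)
    (i j : Fin n) : ContDiffOn ℝ ∞ (fun y => (H y)⁻¹ i j) U := by
  have contDiffOn_det {A : EuclideanSpace ℝ (Fin n) → Matrix (Fin n) (Fin n) ℝ}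
      (hA : ∀ i j, ContDiffOn ℝ ∞ (fun y => A y i j) U) :
      ContDiffOn ℝ ∞ (fun y => (A y).det) U := by
    simp only [Matrix.det_apply']
    fun_prop
  have hadj : ContDiffOn ℝ ∞ (fun y => (H y).adjugate i j) U := by
    simp only [Matrix.adjugate_apply]
    refine contDiffOn_det fun k l => ?_
    by_cases hk : k = j
    · simpa [hk] using contDiffOn_const
    · simpa [hk] using hH k l
  simp only [Matrix.inv_def, Ring.inverse_eq_inv', Matrix.smul_apply, smul_eq_mul]
  exact ((contDiffOn_det hH).inv hdet).mul hadj

theorem contDiffOn_christoffel_hess (hU : IsOpen U) (hΦ : ContDiffOn ℝ ∞ Φ U)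
    (hdet : ∀ y ∈ U, (hess Φ y).det ≠ 0) (k i j : Fin n) :
    ContDiffOn ℝ ∞ (christoffel (hess Φ) k i j) U := by
  have hinv := contDiffOn_inv_apply (H := hess Φ) (fun i j =>
    contDiffOn_iterDirDeriv (e := coordFrame) hU hΦ [i, j]) hdet
  have hD := fun l => contDiffOn_iterDirDeriv (e := coordFrame) hU hΦ [i, j, l]
  refine ContDiffOn.congr ?_ fun y hy => christoffel_hess hU hΦ hy k i j
  exact contDiffOn_const.mul (ContDiffOn.sum fun l _ => (hinv k l).mul (hD l))

theorem sum_hess_mul_pd_christoffel (hU : IsOpen U) (hΦ : ContDiffOn ℝ ∞ Φ U)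
    (hdet : ∀ y ∈ U, (hess Φ y).det ≠ 0) (hx : x ∈ U) (p i j k : Fin n) :
    ∑ l, hess Φ x p l * pd i (christoffel (hess Φ) l j k) x =
      1 / 2 * 𝒟 [i, j, k, p] x - ∑ l, 𝒟 [i, p, l] x * christoffel (hess Φ) l j k x := by
  have hdD := differentiableAt_iterDirDeriv (e := coordFrame) hU hΦ hx
  have hdΓ : ∀ l, DifferentiableAt ℝ (christoffel (hess Φ) l j k) x := fun l =>
    ((contDiffOn_christoffel_hess hU hΦ hdet l j k).contDiffAt (hU.mem_nhds hx)).differentiableAt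
      (by simp)
  have h := dirDeriv_congr (v := coordFrame i) hU
    (fun y hy => sum_hess_mul_christoffel hU hΦ hy (hdet y hy) p j k) hx
  have hlhs : dirDeriv (coordFrame i) (fun y => ∑ l, 𝒟 [p, l] y * christoffel (hess Φ) l j k y) x =
      ∑ l, (𝒟 [i, p, l] x * christoffel (hess Φ) l j k x +
        𝒟 [p, l] x * pd i (christoffel (hess Φ) l j k) x) :=
    (dirDeriv_sum fun l _ => (hdD [p, l]).mul (hdΓ l)).trans
      (Finset.sum_congr rfl fun l _ => dirDeriv_mul (hdD [p, l]) (hdΓ l))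
  simp only [hess_apply] at h ⊢
  rw [hlhs, Finset.sum_add_distrib, dirDeriv_mul (differentiableAt_const _) (hdD _),
    dirDeriv_const, zero_mul, zero_add] at h
  exact eq_sub_of_add_eq' h

theorem sum_hess_mul_riemannCurv (hU : IsOpen U) (hΦ : ContDiffOn ℝ ∞ Φ U)
    (hdet : ∀ y ∈ U, (hess Φ y).det ≠ 0) (hx : x ∈ U) (p i j k : Fin n) :
    ∑ l, hess Φ x p l * riemannCurv (hess Φ) l i j k x =
      1 / 2 * ∑ m, (𝒟 [j, m, p] x * christoffel (hess Φ) m i k x -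
        𝒟 [i, m, p] x * christoffel (hess Φ) m j k x) := by
  have hperm₃ : ∀ a b c, 𝒟 [a, b, c] x = 𝒟 [a, c, b] x := fun a b c =>
    eqOn_iterDirDeriv_of_perm hU hΦ (.cons a (.swap c b [])) hx
  have hperm₄ : 𝒟 [j, i, k, p] x = 𝒟 [i, j, k, p] x :=
    eqOn_iterDirDeriv_of_perm hU hΦ (.swap i j [k, p]) hx
  have hquad : ∀ a b, ∑ l, hess Φ x p l *
      ∑ m, christoffel (hess Φ) l a m x * christoffel (hess Φ) m b k x =
      1 / 2 * ∑ m, 𝒟 [a, m, p] x * christoffel (hess Φ) m b k x := fun a b => by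
    simp only [Finset.mul_sum, ← mul_assoc, ← sum_hess_mul_christoffel hU hΦ hx (hdet x hx),
      Finset.sum_mul]
    exact Finset.sum_comm
  have hi := sum_hess_mul_pd_christoffel hU hΦ hdet hx p i j k
  have hj := sum_hess_mul_pd_christoffel hU hΦ hdet hx p j i k
  simp only [hperm₃ _ p] at hi hj
  simp only [riemannCurv, Finset.sum_sub_distrib, mul_add, mul_sub, Finset.sum_add_distrib, hquad,
    hi, hj, hperm₄]
  ring

theorem metricInner_single_single (h : EuclideanSpace ℝ (Fin n) → Matrix (Fin n) (Fin n) ℝ)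
    (i j : Fin n) : metricInner h x (Pi.single i 1) (Pi.single j 1) = h x i j := by
  simp [metricInner, Pi.single_apply]

theorem sectionalCurvature_hess_single (hU : IsOpen U) (hΦ : ContDiffOn ℝ ∞ Φ U)
    (hdet : ∀ y ∈ U, (hess Φ y).det ≠ 0) (hx : x ∈ U) (i j : Fin n) :
    sectionalCurvature (hess Φ) x (Pi.single i 1) (Pi.single j 1) =
      1 / 4 * (∑ m, ∑ l, (hess Φ x)⁻¹ m l *
        (𝒟 [i, j, m] x * 𝒟 [i, j, l] x - 𝒟 [i, i, m] x * 𝒟 [j, j, l] x)) /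
        (𝒟 [i, i] x * 𝒟 [j, j] x - 𝒟 [i, j] x ^ 2) := by
  have hperm : ∀ a b, 𝒟 [a, b, i] x = 𝒟 [i, a, b] x := fun a b =>
    eqOn_iterDirDeriv_of_perm hU hΦ (List.perm_append_comm (l₁ := [a, b]) (l₂ := [i])) hx
  have hnum : metricInner (hess Φ) x (fun l => ∑ a, ∑ b, ∑ c, riemannCurv (hess Φ) l a b c x *
      (Pi.single i 1 : Fin n → ℝ) a * (Pi.single j 1 : Fin n → ℝ) b *
        (Pi.single j 1 : Fin n → ℝ) c) (Pi.single i 1) =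
      ∑ l, hess Φ x i l * riemannCurv (hess Φ) l i j j x := by
    simp [metricInner, Pi.single_apply, hess_symm hU hΦ hx _ i]
  rw [sectionalCurvature, hnum, sum_hess_mul_riemannCurv hU hΦ hdet hx]
  simp only [metricInner_single_single, christoffel_hess hU hΦ hx, hess_apply]
  simp only [hperm, Finset.mul_sum, ← Finset.sum_sub_distrib]
  refine congrArg (· / _) (Finset.sum_congr rfl fun m _ => Finset.sum_congr rfl fun l _ => ?_)
  ring

end HessianMetric

section CurvatureOfSurface

variable {U : Set (EuclideanSpace ℝ (Fin 2))} {Φ : EuclideanSpace ℝ (Fin 2) → ℝ}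
  {x : EuclideanSpace ℝ (Fin 2)}

theorem hessPolarDet_coordFrame (hU : IsOpen U) (hΦ : ContDiffOn ℝ ∞ Φ U) (hx : x ∈ U) :
    hessPolarDet coordFrame Φ [] [] x = 2 * (hess Φ x).det := by
  rw [Matrix.det_fin_two, hess_symm hU hΦ hx 1 0]
  simp only [hess_apply, hessPolarDet, List.nil_append]
  ring

theorem lam_mul_hessDet_sq_coordFrame (hU : IsOpen U) (hΦ : ContDiffOn ℝ ∞ Φ U)
    (hdet : ∀ y ∈ U, (hess Φ y).det ≠ 0) (hx : x ∈ U) :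
    lam Φ x * hessPolarDet coordFrame Φ [] [] x ^ 2 =
      4 * hessTripleDet coordFrame Φ [] [0] [1] x := by
  have hd := hdet x hx
  have hdisc : iterDirDeriv coordFrame Φ [0, 0] x * iterDirDeriv coordFrame Φ [1, 1] x -
      iterDirDeriv coordFrame Φ [0, 1] x ^ 2 = (hess Φ x).det := by
    rw [Matrix.det_fin_two, hess_symm hU hΦ hx 1 0, sq]
    rfl
  rw [hessPolarDet_coordFrame hU hΦ hx, lam, sectionalCurvature_hess_single hU hΦ hdet hx, hdisc,
    Matrix.inv_def, Ring.inverse_eq_inv', Matrix.adjugate_fin_two]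
  simp only [Fin.sum_univ_two, Matrix.smul_apply, Matrix.of_apply, Matrix.cons_val',
    Matrix.cons_val_zero, Matrix.cons_val_one, Matrix.cons_val_fin_one, smul_eq_mul, hessTripleDet,
    hess_apply]
  field_simp
  simp only [List.nil_append, List.cons_append, iterDirDeriv_eq_frameJet hU hΦ hx,
    List.count_cons_self, List.count_cons_of_ne, List.count_nil, ne_eq, one_ne_zero, zero_ne_one,
    not_false_eq_true, zero_add, Nat.reduceAdd]
  ring

theorem contDiffOn_lam (hU : IsOpen U) (hΦ : ContDiffOn ℝ ∞ Φ U)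
    (hdet : ∀ y ∈ U, (hess Φ y).det ≠ 0) : ContDiffOn ℝ ∞ (lam Φ) U := by
  have hD := contDiffOn_iterDirDeriv (e := coordFrame) hU hΦ
  have hQ : ∀ y ∈ U, hessPolarDet coordFrame Φ [] [] y ^ 2 ≠ 0 := fun y hy => by
    rw [hessPolarDet_coordFrame hU hΦ hy]
    exact pow_ne_zero 2 (mul_ne_zero two_ne_zero (hdet y hy))
  have hquot : Set.EqOn (lam Φ) (fun y => 4 * hessTripleDet coordFrame Φ [] [0] [1] y /
      hessPolarDet coordFrame Φ [] [] y ^ 2) U := fun y hy =>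
    eq_div_of_mul_eq (hQ y hy) (lam_mul_hessDet_sq_coordFrame hU hΦ hdet hy)
  refine ContDiffOn.congr ?_ hquot
  refine ContDiffOn.div ?_ ?_ hQ
  · unfold hessTripleDet
    fun_prop
  · unfold hessPolarDet
    fun_prop

end CurvatureOfSurface

section OrthogonalFrame

theorem inv_eq_smul_transpose_mul {n : Type*} [Fintype n] [DecidableEq n] {R : Type*} [CommRing R]
    {P H : Matrix n n R} {ε : R} (hε : ε ^ 2 = 1) (h : P * H * P.transpose = ε • 1) :
    H⁻¹ = ε • (P.transpose * P) := by
  have hright : P * (ε • (H * P.transpose)) = 1 := by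
    rw [Matrix.mul_smul, ← Matrix.mul_assoc, h, smul_smul, ← sq, hε, one_smul]
  have hleft := mul_eq_one_comm.1 hright
  refine Matrix.inv_eq_right_inv ?_
  rw [Matrix.mul_smul, ← Matrix.mul_assoc, ← Matrix.smul_mul, hleft]

theorem exists_mul_mul_transpose_eq_smul_one {H : Matrix (Fin 2) (Fin 2) ℝ} (hsymm : H.IsSymm)
    (hdet : 0 < H.det) :
    ∃ (P : Matrix (Fin 2) (Fin 2) ℝ) (ε : ℝ), ε ^ 2 = 1 ∧ P * H * P.transpose = ε • 1 := by
  obtain ⟨a, b, c, rfl⟩ : ∃ a b c, H = !![a, b; b, c] :=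
    ⟨H 0 0, H 0 1, H 1 1, by rw [Matrix.eta_fin_two H, hsymm.apply 0 1]; rfl⟩
  rw [Matrix.det_fin_two_of] at hdet
  have ha : a ≠ 0 := by
    rintro rfl
    nlinarith [sq_nonneg b]
  obtain ⟨r, hr, hr0⟩ : ∃ r, r ^ 2 = |a| ∧ r ≠ 0 :=
    ⟨√|a|, Real.sq_sqrt (abs_nonneg a), (Real.sqrt_pos.2 (abs_pos.2 ha)).ne'⟩
  obtain ⟨d, hd, hd0⟩ : ∃ d, d ^ 2 = a * c - b * b ∧ d ≠ 0 :=
    ⟨√(a * c - b * b), Real.sq_sqrt hdet.le, (Real.sqrt_pos.2 hdet).ne'⟩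
  -- The rows of `P` are the standard basis after Gram–Schmidt for the form `H`.
  refine ⟨!![1 / r, 0; -b / (r * d), a / (r * d)], a / r ^ 2, ?_, ?_⟩
  · rw [hr, div_pow, sq_abs, div_self (pow_ne_zero 2 ha)]
  · have hnorm : (-b / (r * d) * a + a / (r * d) * b) * (-b / (r * d)) +
        (-b / (r * d) * b + a / (r * d) * c) * (a / (r * d)) = a / r ^ 2 := by
      field_simp
      linear_combination -hd
    rw [Matrix.eta_fin_two (Matrix.transpose _), Matrix.mul_fin_two]
    simp only [Matrix.transpose_apply, Matrix.of_apply, Matrix.cons_val_zero, Matrix.cons_val_one,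
      Matrix.mul_fin_two, Matrix.cons_val', Matrix.cons_val_fin_one]
    rw [hnorm, Matrix.one_fin_two, Matrix.smul_of]
    simp only [one_div, zero_mul, add_zero, mul_zero, Matrix.smul_cons, smul_eq_mul, mul_one,
      Matrix.smul_empty, EmbeddingLike.apply_eq_iff_eq, Matrix.vecCons_inj, and_true]
    refine ⟨⟨?_, ?_⟩, ?_⟩ <;> field_simp <;> ring

end OrthogonalFrame

section NormalFrame

variable {n : ℕ} {U : Set (EuclideanSpace ℝ (Fin n))} {Φ f g : EuclideanSpace ℝ (Fin n) → ℝ}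
  {x : EuclideanSpace ℝ (Fin n)} {P : Matrix (Fin n) (Fin n) ℝ} {ε : ℝ}

theorem hess_changeFrame (hU : IsOpen U) (hΦ : ContDiffOn ℝ ∞ Φ U) (hx : x ∈ U) (k l : Fin n) :
    iterDirDeriv (changeFrame P coordFrame) Φ [k, l] x =
      (P * hess Φ x * P.transpose) k l := by
  rw [iterDirDeriv_changeFrame₂ hU hΦ hx, Matrix.mul_assoc, Matrix.mul_apply]
  simp only [Matrix.mul_apply, Matrix.transpose_apply, hess_apply, mul_comm]

theorem gradInner_eq_sum (hU : IsOpen U) (hΦ : ContDiffOn ℝ ∞ Φ U) (hx : x ∈ U)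
    (hdet : (hess Φ x).det ≠ 0) :
    gradInner Φ f g x = ∑ i, ∑ j, (hess Φ x)⁻¹ i j * (pd i f x * pd j g x) := by
  have hlower : ∀ j, ∑ i, hess Φ x i j * riemGrad (hess Φ) f x i = pd j f x := fun j => by
    simp only [hess_symm hU hΦ hx _ j]
    change (hess Φ x).mulVec ((hess Φ x)⁻¹.mulVec fun i => pd i f x) j = pd j f x
    rw [Matrix.mulVec_mulVec, Matrix.mul_nonsing_inv _ hdet.isUnit, Matrix.one_mulVec]
  calc gradInner Φ f g x
      = ∑ j, (∑ i, hess Φ x i j * riemGrad (hess Φ) f x i) * riemGrad (hess Φ) g x j := by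
        simp only [gradInner, metricInner, Finset.sum_mul]
        exact Finset.sum_comm
    _ = ∑ i, ∑ j, (hess Φ x)⁻¹ i j * (pd i f x * pd j g x) := by
        simp only [hlower]
        simp only [riemGrad, Finset.mul_sum, mul_left_comm]

theorem sum_inv_hess_mul (hε : ε ^ 2 = 1) (hP : P * hess Φ x * P.transpose = ε • 1)
    (F : Fin n → Fin n → ℝ) :
    ∑ i, ∑ j, (hess Φ x)⁻¹ i j * F i j = ε * ∑ k, ∑ i, P k i * ∑ j, P k j * F i j := by
  simp only [inv_eq_smul_transpose_mul hε hP, Matrix.smul_apply, Matrix.mul_apply,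
    Matrix.transpose_apply, smul_eq_mul, Finset.mul_sum, Finset.sum_mul, mul_assoc]
  rw [Finset.sum_comm_cycle]

theorem gradInner_changeFrame (hU : IsOpen U) (hΦ : ContDiffOn ℝ ∞ Φ U) (hx : x ∈ U)
    (hdet : (hess Φ x).det ≠ 0) (hε : ε ^ 2 = 1) (hP : P * hess Φ x * P.transpose = ε • 1) :
    gradInner Φ f g x = ε * ∑ k, dirDeriv (changeFrame P coordFrame k) f x *
      dirDeriv (changeFrame P coordFrame k) g x := by
  rw [gradInner_eq_sum hU hΦ hx hdet, sum_inv_hess_mul hε hP fun i j => pd i f x * pd j g x]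
  refine congrArg (ε * ·) (Finset.sum_congr rfl fun k _ => ?_)
  rw [dirDeriv_changeFrame, dirDeriv_changeFrame, Finset.sum_mul_sum]
  simp only [Finset.mul_sum, mul_assoc, mul_left_comm (dirDeriv _ _ _)]
  rfl

theorem weightedLaplacian_changeFrame (hU : IsOpen U) (hf : ContDiffOn ℝ ∞ f U) (hx : x ∈ U)
    (hε : ε ^ 2 = 1) (hP : P * hess Φ x * P.transpose = ε • 1) :
    weightedLaplacian Φ f x =
      ε * ∑ k, iterDirDeriv (changeFrame P coordFrame) f [k, k] x := by
  simp only [iterDirDeriv_changeFrame₂ hU hf hx]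
  exact sum_inv_hess_mul hε hP _

end NormalFrame

section PointwiseAlgebra

/-- The relations satisfied by the derivatives `J m n = ∂₀ᵐ ∂₁ⁿ Φ` of a solution of
`e^{-Φ} = det D²Φ` in a frame in which `D²Φ` is `ε` times the identity, `ε = ±1` being the sign of
the metric. The equations are the first, second and third derivatives of the logarithm of the
equation, solved for the traces of the derivatives of `D²Φ`. -/
structure IsKEJet (ε : ℝ) (J : ℕ → ℕ → ℝ) : Prop where
  sq_eq_one : ε ^ 2 = 1
  order₁₀ : J 1 0 = -ε * (J 3 0 + J 1 2)
  order₀₁ : J 0 1 = -ε * (J 2 1 + J 0 3)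
  order₂₀ : J 4 0 + J 2 2 = ε * (J 1 0 ^ 2 - 2 * (J 3 0 * J 1 2 - J 2 1 ^ 2)) - 1
  order₁₁ : J 3 1 + J 1 3 = ε * (J 1 0 * J 0 1 - (J 3 0 * J 0 3 - J 2 1 * J 1 2))
  order₀₂ : J 2 2 + J 0 4 = ε * (J 0 1 ^ 2 - 2 * (J 2 1 * J 0 3 - J 1 2 ^ 2)) - 1
  order₃₀ : J 3 2 + J 5 0 = 3 * J 1 0 - ε * (J 1 0 ^ 3 + J 3 0 +
    3 * (J 4 0 * J 1 2 + J 3 0 * J 2 2 - 2 * J 2 1 * J 3 1))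
  order₂₁ : J 2 3 + J 4 1 = J 0 1 - ε * (J 1 0 ^ 2 * J 0 1 + J 2 1 +
    (J 4 0 * J 0 3 + 2 * J 3 0 * J 1 3 - 3 * J 2 1 * J 2 2))
  order₁₂ : J 3 2 + J 1 4 = J 1 0 - ε * (J 1 0 * J 0 1 ^ 2 + J 1 2 +
    (J 3 0 * J 0 4 + 2 * J 0 3 * J 3 1 - 3 * J 1 2 * J 2 2))
  order₀₃ : J 2 3 + J 0 5 = 3 * J 0 1 - ε * (J 0 1 ^ 3 + J 0 3 +
    3 * (J 2 1 * J 0 4 + J 0 3 * J 2 2 - 2 * J 1 2 * J 1 3))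

/-- The expressions of `l = λ`, its derivatives `l₁ = ∂₀λ`, `l₂ = ∂₁λ` and `L = Lλ` through the
derivatives `J m n = ∂₀ᵐ ∂₁ⁿ Φ` in a frame in which `D²Φ` is `ε` times the identity. -/
structure IsCurvatureJet (ε : ℝ) (J : ℕ → ℕ → ℝ) (l l₁ l₂ L : ℝ) : Prop where
  curv : l = ε * (J 2 1 * (J 2 1 - J 0 3) - J 1 2 * (J 3 0 - J 1 2))
  deriv₁ : l₁ = 2 * J 1 0 * l + ε * (J 3 1 * (J 2 1 - J 0 3) - J 1 2 * (J 4 0 - J 2 2) +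
    (J 2 1 * (J 3 1 - J 1 3) - J 2 2 * (J 3 0 - J 1 2)))
  deriv₂ : l₂ = 2 * J 0 1 * l + ε * (J 2 2 * (J 2 1 - J 0 3) - J 1 2 * (J 3 1 - J 1 3) +
    (J 2 1 * (J 2 2 - J 0 4) - J 1 3 * (J 3 0 - J 1 2)))
  laplacian : L = 4 * l + 4 * ε * (J 1 0 * l₁ + J 0 1 * l₂ - (J 1 0 ^ 2 + J 0 1 ^ 2) * l)
    - ε * ((J 4 0 + J 2 2) * (J 1 2 ^ 2 - J 2 1 * J 0 3)
      + (J 3 1 + J 1 3) * (J 3 0 * J 0 3 - J 2 1 * J 1 2)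
      + (J 2 2 + J 0 4) * (J 2 1 ^ 2 - J 3 0 * J 1 2))
    + ((J 2 3 + J 4 1) * (J 2 1 - J 0 3) - J 1 2 * (J 5 0 - J 1 4)
      + J 2 1 * (J 4 1 - J 0 5) - (J 3 2 + J 1 4) * (J 3 0 - J 1 2))
    + 2 * (J 3 1 * (J 3 1 - J 1 3) - J 2 2 * (J 4 0 - J 2 2)
      + (J 2 2 * (J 2 2 - J 0 4) - J 1 3 * (J 3 1 - J 1 3)))

/-- The real part of `D³Φ(Z, Z, Z)` for `Z = e₀ - i e₁`. The cubic form `D³Φ(Z, Z, Z)` is the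
trace-free part of `D³Φ`. -/
def cubicRe (J : ℕ → ℕ → ℝ) : ℝ := J 3 0 - 3 * J 1 2

/-- The imaginary part of `D³Φ(Z, Z, Z)` for `Z = e₀ - i e₁`. -/
def cubicIm (J : ℕ → ℕ → ℝ) : ℝ := J 0 3 - 3 * J 2 1

/-- The real part of `(∇D³Φ)(Z, Z, Z, Z)` for `Z = e₀ - i e₁`, where `∇` is the Levi-Civita
connection of `D²Φ`; the trace `∑ᵢ Φᵢᵢₖ = -ε Φₖ` is inserted in the Christoffel terms. -/
noncomputable def quarticRe (J : ℕ → ℕ → ℝ) : ℝ :=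
  J 4 0 - 6 * J 2 2 + J 0 4 + 3 / 2 * (cubicRe J * J 1 0 + cubicIm J * J 0 1)

/-- The imaginary part of `(∇D³Φ)(Z, Z, Z, Z)` for `Z = e₀ - i e₁`, see `quarticRe`. -/
noncomputable def quarticIm (J : ℕ → ℕ → ℝ) : ℝ :=
  4 * J 1 3 - 4 * J 3 1 + 3 / 2 * (cubicIm J * J 1 0 - cubicRe J * J 0 1)

variable {ε l l₁ l₂ L : ℝ} {J : ℕ → ℕ → ℝ}

theorem norm_cubic_sq (hJ : IsKEJet ε J) (hl : IsCurvatureJet ε J l l₁ l₂ L) :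
    8 * l + ε * (J 1 0 ^ 2 + J 0 1 ^ 2) = ε * (cubicRe J ^ 2 + cubicIm J ^ 2) := by
  rw [hl.curv, hJ.order₁₀, hJ.order₀₁]
  unfold cubicRe cubicIm
  rcases sq_eq_one_iff.1 hJ.sq_eq_one with rfl | rfl <;> ring

theorem gradient₁_eq (hJ : IsKEJet ε J) (hl : IsCurvatureJet ε J l l₁ l₂ L) :
    4 * l₁ + (1 - l + ε * (J 1 0 ^ 2 + J 0 1 ^ 2) / 4) * J 1 0 =
      ε / 2 * (cubicRe J * quarticRe J + cubicIm J * quarticIm J) := by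
  unfold quarticRe quarticIm cubicRe cubicIm
  rw [hl.deriv₁, hl.curv, eq_sub_of_add_eq' hJ.order₁₁, eq_sub_of_add_eq' hJ.order₀₂,
    eq_sub_of_add_eq' hJ.order₂₀, hJ.order₁₀, hJ.order₀₁]
  rcases sq_eq_one_iff.1 hJ.sq_eq_one with rfl | rfl <;> ring

theorem gradient₂_eq (hJ : IsKEJet ε J) (hl : IsCurvatureJet ε J l l₁ l₂ L) :
    4 * l₂ + (1 - l + ε * (J 1 0 ^ 2 + J 0 1 ^ 2) / 4) * J 0 1 =
      ε / 2 * (cubicIm J * quarticRe J - cubicRe J * quarticIm J) := by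
  unfold quarticRe quarticIm cubicRe cubicIm
  rw [hl.deriv₂, hl.curv, eq_sub_of_add_eq' hJ.order₁₁, eq_sub_of_add_eq' hJ.order₀₂,
    eq_sub_of_add_eq' hJ.order₂₀, hJ.order₁₀, hJ.order₀₁]
  rcases sq_eq_one_iff.1 hJ.sq_eq_one with rfl | rfl <;> ring

theorem bochner_formula (hJ : IsKEJet ε J) (hl : IsCurvatureJet ε J l l₁ l₂ L) :
    8 * L = quarticRe J ^ 2 + quarticIm J ^ 2 + 4 * (3 * l - 1) * (l + 1) +
      ε * (J 1 0 ^ 2 + J 0 1 ^ 2) * (16 * l - 8 - ε * (J 1 0 ^ 2 + J 0 1 ^ 2)) / 4 := by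
  unfold quarticRe quarticIm cubicRe cubicIm
  rw [hl.laplacian, hl.deriv₁, hl.deriv₂, hl.curv, eq_sub_of_add_eq' hJ.order₃₀,
    eq_sub_of_add_eq' hJ.order₂₁, eq_sub_of_add_eq' hJ.order₁₂, eq_sub_of_add_eq' hJ.order₀₃,
    eq_sub_of_add_eq' hJ.order₁₁, eq_sub_of_add_eq' hJ.order₀₂, eq_sub_of_add_eq' hJ.order₂₀,
    hJ.order₁₀, hJ.order₀₁]
  rcases sq_eq_one_iff.1 hJ.sq_eq_one with rfl | rfl <;> ring

theorem laplacian_curvature_eq (hJ : IsKEJet ε J) (hl : IsCurvatureJet ε J l l₁ l₂ L) {w : ℝ}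
    (hw : w = ε * (J 1 0 ^ 2 + J 0 1 ^ 2)) :
    2 * (8 * l + w) * L = (8 * l + w) * ((3 * l - 1) * (l + 1)) + w * (3 * l - 1) ^ 2 +
      16 * (ε * (l₁ ^ 2 + l₂ ^ 2)) +
      2 * (4 * (1 - l) + w) * (ε * (J 1 0 * l₁ + J 0 1 * l₂)) := by
  have hcubic := norm_cubic_sq hJ hl
  have hgrad₁ := gradient₁_eq hJ hl
  have hgrad₂ := gradient₂_eq hJ hl
  have hbochner := bochner_formula hJ hl
  rw [← hw] at hcubic hgrad₁ hgrad₂ hbochner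
  -- In dimension two Kato's inequality is the equality `|c|² |q|² = |c q̄|²` of complex numbers.
  have hkato : (8 * l + w) * (quarticRe J ^ 2 + quarticIm J ^ 2) =
      4 * ε * ((4 * l₁ + (1 - l + w / 4) * J 1 0) ^ 2 +
        (4 * l₂ + (1 - l + w / 4) * J 0 1) ^ 2) := by
    rw [hcubic, hgrad₁, hgrad₂]
    rcases sq_eq_one_iff.1 hJ.sq_eq_one with rfl | rfl <;> ring
  linear_combination (8 * l + w) / 4 * hbochner + hkato / 4 - (1 - l + w / 4) ^ 2 * hw

end PointwiseAlgebra

section JetsOfSolution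

variable {V : Type*} [NormedAddCommGroup V] [NormedSpace ℝ V] {U : Set V} {e : Fin 2 → V}
  {φ σ : V → ℝ} {ε κ : ℝ} {x : V}

theorem isKEJet_frameJet (hU : IsOpen U) (hφ : ContDiffOn ℝ ∞ φ U)
    (hKE : ∀ y ∈ U, hessPolarDet e φ [] [] y = κ * Real.exp (-φ y)) (hx : x ∈ U) (hε : ε ^ 2 = 1)
    (h₂₀ : frameJet e φ x 2 0 = ε) (h₁₁ : frameJet e φ x 1 1 = 0)
    (h₀₂ : frameJet e φ x 0 2 = ε) : IsKEJet ε (frameJet e φ x) := by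
  have hderiv₁ := kahlerEinstein_deriv₁ hU hφ hKE hx
  have hderiv₂ := kahlerEinstein_deriv₂ hU hφ hKE hx
  have hderiv₃ := kahlerEinstein_deriv₃ hU hφ hKE hx
  simp only [hessPolarDet, List.nil_append, List.cons_append, iterDirDeriv_eq_frameJet hU hφ hx,
    List.count_cons_self, List.count_cons_of_ne, List.count_nil, ne_eq, one_ne_zero, zero_ne_one,
    not_false_eq_true, zero_add, Nat.reduceAdd, Fin.forall_fin_two, h₂₀, h₁₁, h₀₂]
    at hderiv₁ hderiv₂ hderiv₃
  obtain ⟨h₁₀, h₀₁⟩ := hderiv₁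
  obtain ⟨⟨h₂₀, h₁₁⟩, -, h₀₂⟩ := hderiv₂
  obtain ⟨⟨⟨h₃₀, h₂₁⟩, -, h₁₂⟩, -, -, h₀₃⟩ := hderiv₃
  rcases sq_eq_one_iff.1 hε with rfl | rfl <;> constructor <;> linarith

theorem isCurvatureJet_frameJet (hU : IsOpen U) (hφ : ContDiffOn ℝ ∞ φ U)
    (hKE : ∀ y ∈ U, hessPolarDet e φ [] [] y = κ * Real.exp (-φ y)) (hσ : ContDiffOn ℝ ∞ σ U)
    (hcurv : ∀ y ∈ U, σ y * hessPolarDet e φ [] [] y ^ 2 = 4 * hessTripleDet e φ [] [0] [1] y)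
    (hx : x ∈ U) (hε : ε ^ 2 = 1) (h₂₀ : frameJet e φ x 2 0 = ε) (h₁₁ : frameJet e φ x 1 1 = 0)
    (h₀₂ : frameJet e φ x 0 2 = ε) :
    IsCurvatureJet ε (frameJet e φ x) (σ x) (dirDeriv (e 0) σ x) (dirDeriv (e 1) σ x)
      (ε * (iterDirDeriv e σ [0, 0] x + iterDirDeriv e σ [1, 1] x)) := by
  have h₀₀ := hcurv x hx
  have hderiv₁ := curvature_deriv₁ hU hφ hKE hσ hcurv hx
  have hderiv₂ := curvature_deriv₂ hU hφ hKE hσ hcurv hx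
  simp only [hessPolarDet, hessTripleDet, List.nil_append, List.cons_append,
    iterDirDeriv_eq_frameJet hU hφ hx, List.count_cons_self, List.count_cons_of_ne, List.count_nil,
    ne_eq, one_ne_zero, zero_ne_one, not_false_eq_true, zero_add, Nat.reduceAdd,
    Fin.forall_fin_two, h₂₀, h₁₁, h₀₂] at h₀₀ hderiv₁ hderiv₂
  obtain ⟨h₁₀, h₀₁⟩ := hderiv₁
  obtain ⟨h₂₀, h₀₂⟩ := hderiv₂
  simp only [iterDirDeriv, List.foldr]
  rcases sq_eq_one_iff.1 hε with rfl | rfl <;> constructor <;> linarith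

end JetsOfSolution

section Equation

variable {U : Set (EuclideanSpace ℝ (Fin 2))} {Φ : EuclideanSpace ℝ (Fin 2) → ℝ}
  {x : EuclideanSpace ℝ (Fin 2)}

theorem exists_isKEJet_isCurvatureJet (hU : IsOpen U) (hΦ : ContDiffOn ℝ ∞ Φ U)
    (hKE : ∀ y ∈ U, Real.exp (-Φ y) = (hess Φ y).det) (hx : x ∈ U) :
    ∃ ε J l₁ l₂, IsKEJet ε J ∧
      IsCurvatureJet ε J (lam Φ x) l₁ l₂ (weightedLaplacian Φ (lam Φ) x) ∧
      gradInner Φ Φ Φ x = ε * (J 1 0 ^ 2 + J 0 1 ^ 2) ∧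
      gradInner Φ Φ (lam Φ) x = ε * (J 1 0 * l₁ + J 0 1 * l₂) ∧
      gradInner Φ (lam Φ) (lam Φ) x = ε * (l₁ ^ 2 + l₂ ^ 2) := by
  have hdet : ∀ y ∈ U, (hess Φ y).det ≠ 0 := fun y hy => hKE y hy ▸ Real.exp_ne_zero _
  have hlam := contDiffOn_lam hU hΦ hdet
  obtain ⟨P, ε, hε, hP⟩ := exists_mul_mul_transpose_eq_smul_one
    (Matrix.IsSymm.ext fun i j => hess_symm hU hΦ hx j i) (hKE x hx ▸ Real.exp_pos _)
  set e := changeFrame P coordFrame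
  have hKE' : ∀ y ∈ U, hessPolarDet e Φ [] [] y = P.det ^ 2 * 2 * Real.exp (-Φ y) := fun y hy => by
    rw [hessPolarDet_changeFrame hU hΦ hy, hessPolarDet_coordFrame hU hΦ hy, hKE y hy, mul_assoc]
  have hcurv : ∀ y ∈ U, lam Φ y * hessPolarDet e Φ [] [] y ^ 2 =
      4 * hessTripleDet e Φ [] [0] [1] y := fun y hy => by
    rw [hessPolarDet_changeFrame hU hΦ hy, hessTripleDet_changeFrame hU hΦ hy]
    linear_combination P.det ^ 4 * lam_mul_hessDet_sq_coordFrame hU hΦ hdet hy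
  have hnormal : ∀ k l, iterDirDeriv e Φ [k, l] x = (ε • (1 : Matrix _ _ ℝ)) k l := fun k l => by
    rw [hess_changeFrame hU hΦ hx, hP]
  have h₂₀ : frameJet e Φ x 2 0 = ε := (hnormal 0 0).trans (by simp)
  have h₁₁ : frameJet e Φ x 1 1 = 0 := (hnormal 0 1).trans (by simp)
  have h₀₂ : frameJet e Φ x 0 2 = ε := (hnormal 1 1).trans (by simp)
  have hgrad := fun f g => gradInner_changeFrame (f := f) (g := g) hU hΦ hx (hdet x hx) hε hP
  refine ⟨ε, frameJet e Φ x, dirDeriv (e 0) (lam Φ) x, dirDeriv (e 1) (lam Φ) x,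
    isKEJet_frameJet hU hΦ hKE' hx hε h₂₀ h₁₁ h₀₂, ?_, ?_, ?_, ?_⟩
  · rw [weightedLaplacian_changeFrame hU hlam hx hε hP, Fin.sum_univ_two]
    exact isCurvatureJet_frameJet hU hΦ hKE' hlam hcurv hx hε h₂₀ h₁₁ h₀₂
  · rw [hgrad, Fin.sum_univ_two, ← sq, ← sq]
    rfl
  · rw [hgrad, Fin.sum_univ_two]
    rfl
  · rw [hgrad, Fin.sum_univ_two, ← sq, ← sq]

end Equation

end HessianGeometry

open HessianGeometry in
theorem mainTheorem2_general {Φ : EuclideanSpace ℝ (Fin 2) → ℝ} {U : Set (EuclideanSpace ℝ (Fin 2))}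
    {x : EuclideanSpace ℝ (Fin 2)} (hU : IsOpen U) (hΦ : ContDiffOn ℝ ∞ Φ U)
    (hKE : ∀ y ∈ U, Real.exp (-Φ y) = (hess Φ y).det) (hx : x ∈ U) :
    (8 * lam Φ x + gradInner Φ Φ Φ x ≠ 0 →
      2 * weightedLaplacian Φ (lam Φ) x = (3 * lam Φ x - 1) * (lam Φ x + 1) +
        gradInner Φ Φ Φ x / (8 * lam Φ x + gradInner Φ Φ Φ x) * (3 * lam Φ x - 1) ^ 2 +
        (16 * gradInner Φ (lam Φ) (lam Φ) x +
            2 * (4 * (1 - lam Φ x) + gradInner Φ Φ Φ x) * gradInner Φ Φ (lam Φ) x) /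
          (8 * lam Φ x + gradInner Φ Φ Φ x)) ∧
    2 * (8 * lam Φ x + gradInner Φ Φ Φ x) * weightedLaplacian Φ (lam Φ) x =
      (8 * lam Φ x + gradInner Φ Φ Φ x) * ((3 * lam Φ x - 1) * (lam Φ x + 1)) +
        gradInner Φ Φ Φ x * (3 * lam Φ x - 1) ^ 2 + 16 * gradInner Φ (lam Φ) (lam Φ) x +
        2 * (4 * (1 - lam Φ x) + gradInner Φ Φ Φ x) * gradInner Φ Φ (lam Φ) x := by
  obtain ⟨ε, J, l₁, l₂, hJ, hl, hΦΦ, hΦlam, hlamlam⟩ :=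
    exists_isKEJet_isCurvatureJet hU hΦ hKE hx
  have hcleared := laplacian_curvature_eq hJ hl hΦΦ
  rw [← hΦlam, ← hlamlam] at hcleared
  refine ⟨fun hne => ?_, hcleared⟩
  generalize 8 * lam Φ x + gradInner Φ Φ Φ x = D at hne hcleared ⊢
  field_simp
  linear_combination hcleared

theorem mainTheorem2 (Φ : EuclideanSpace ℝ (Fin 2) → ℝ)
    (hsmooth : ContDiff ℝ ∞ Φ)
    (hconvex : ConvexOn ℝ Set.univ Φ)
    (hKE : ∀ x, Real.exp (-Φ x) = (HessianGeometry.hess Φ x).det) :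
    (∀ x, 8 * HessianGeometry.lam Φ x + HessianGeometry.gradInner Φ Φ Φ x ≠ 0 →
      2 * HessianGeometry.weightedLaplacian Φ (HessianGeometry.lam Φ) x =
        (3 * HessianGeometry.lam Φ x - 1) * (HessianGeometry.lam Φ x + 1) +
        HessianGeometry.gradInner Φ Φ Φ x /
            (8 * HessianGeometry.lam Φ x + HessianGeometry.gradInner Φ Φ Φ x) *
          (3 * HessianGeometry.lam Φ x - 1) ^ 2 +
        (16 * HessianGeometry.gradInner Φ (HessianGeometry.lam Φ) (HessianGeometry.lam Φ) x +
            2 * (4 * (1 - HessianGeometry.lam Φ x) + HessianGeometry.gradInner Φ Φ Φ x) *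
              HessianGeometry.gradInner Φ Φ (HessianGeometry.lam Φ) x) /
          (8 * HessianGeometry.lam Φ x + HessianGeometry.gradInner Φ Φ Φ x)) ∧
    (∀ x,
      2 * (8 * HessianGeometry.lam Φ x + HessianGeometry.gradInner Φ Φ Φ x) *
          HessianGeometry.weightedLaplacian Φ (HessianGeometry.lam Φ) x =
        (8 * HessianGeometry.lam Φ x + HessianGeometry.gradInner Φ Φ Φ x) *
          ((3 * HessianGeometry.lam Φ x - 1) * (HessianGeometry.lam Φ x + 1)) +
        HessianGeometry.gradInner Φ Φ Φ x * (3 * HessianGeometry.lam Φ x - 1) ^ 2 +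
        16 * HessianGeometry.gradInner Φ (HessianGeometry.lam Φ) (HessianGeometry.lam Φ) x +
        2 * (4 * (1 - HessianGeometry.lam Φ x) + HessianGeometry.gradInner Φ Φ Φ x) *
          HessianGeometry.gradInner Φ Φ (HessianGeometry.lam Φ) x) :=
  forall_and.1 fun x => mainTheorem2_general isOpen_univ hsmooth.contDiffOn (fun y _ => hKE y)
    (Set.mem_univ x)
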